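/- A compact line is a compact space whose topology is the order topology of a linear order. A point $x$ of a compact line $K$ is internal if it is isolated neither in $[x,\to)$ nor in $(\leftarrow,x]$. For a subset $A$ of a linearly ordered set and $x\in A$ one always has $\mathrm{io}(x,A)\ge 0$, and $\mathrm{io}(x,A)\ge n+1$ means that the sets $\{y\in A: y<x,\ \mathrm{io}(y,A)\ge n\}$ and $\{y\in A: y>x,\ \mathrm{io}(y,A)\ge n\}$ are both nonempty and that $x$ is the supremum of the first and the infimum of the second; $\mathrm{io}(x,A)\in\{0,1,2,\dots,\infty\}$ is the supremum of all $n$ with $\mathrm{io}(x,A)\ge n$, and $\mathrm{io}(A)=\sup_{x\in A}\mathrm{io}(x,A)$, with $\mathrm{io}(\emptyset)=-1$. Let $K$ be a compact line and let $M(K)$ be the set of all internal points of $K$ that have uncountable character (no countable neighbourhood base). Let $\mathcal Q_\omega(K)$ be the set of all metrizable quotients of $K$, i.e. continuous surjections $q:K\to L$ onto metrizable compact spaces, two of them being identified if they have the same fibers, ordered by $q_1\preceq q_2$ iff every fiber of $q_2$ is contained in a fiber of $q_1$. For a quotient represented by an order preserving continuous surjection $q:K\to L$ onto a compact line $L$,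 put $$Q(q)=\{y\in L: y\text{ is an internal point of }L\text{ and }|q^{-1}(y)|>1\}.$$ Then there is a set $\mathcal F\subseteq\mathcal Q_\omega(K)$ such that (i) for every $p\in\mathcal Q_\omega(K)$ there is $q\in\mathcal F$ with $p\preceq q$; (ii) every sequence $q_1\preceq q_2\preceq\cdots$ in $\mathcal F$ has a supremum in $\mathcal Q_\omega(K)$, and this supremum belongs to $\mathcal F$; (iii) every $q\in\mathcal F$ is order preserving (its quotient space carries a linear order that induces its topology and makes the quotient map order preserving) and satisfies $\mathrm{io}(Q(q))\ge\mathrm{io}(M(K))$. -/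

import Mathlib

open Topology

universe u

namespace CompactLine

section InternalOrder

variable {X : Type u} [LinearOrder X]

/-- `OrderGE A n x` says that `x ∈ A` and that the internal order of `x` in `A` is at least `n`. -/
def OrderGE (A : Set X) : ℕ → X → Prop
  | 0, x => x ∈ A
  | n + 1, x => x ∈ A ∧
      {y | y ∈ A ∧ y < x ∧ OrderGE A n y}.Nonempty ∧
      {y | y ∈ A ∧ x < y ∧ OrderGE A n y}.Nonempty ∧
      IsLUB {y | y ∈ A ∧ y < x ∧ OrderGE A n y} x ∧
      IsGLB {y | y ∈ A ∧ x < y ∧ OrderGE A n y} x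

/-- The internal order `io(x, A)` of a point `x ∈ A`, a value in `{0, 1, 2, …, ∞}`. -/
noncomputable def pointOrder (A : Set X) (x : X) : ℕ∞ :=
  ⨆ (n : ℕ) (_ : OrderGE A n x), (n : ℕ∞)

/-- The internal order `io(A)` of a set, a value in `{-1, 0, 1, 2, …, ∞}`; the value `-1`,
taken exactly at the empty set, is represented by `⊥`. -/
noncomputable def internalOrder (A : Set X) : WithBot ℕ∞ :=
  ⨆ (x : X) (_ : x ∈ A), (pointOrder A x : WithBot ℕ∞)

end InternalOrder

section Points

variable {K : Type u} [LinearOrder K] [TopologicalSpace K]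

/-- `x` is external if it is isolated in `[x, →)` or in `(←, x]`, that is, if one of its
punctured one-sided neighbourhood filters is trivial. The least and the greatest
point are external. -/
def IsExternal (x : K) : Prop := 𝓝[>] x = ⊥ ∨ 𝓝[<] x = ⊥

/-- A point is internal if it is not external. -/
def IsInternal (x : K) : Prop := ¬ IsExternal x

variable (K) in
/-- `M(K)`: the internal points of uncountable character (no countable neighbourhood base). -/
def internalUncountable : Set K :=
  {x | IsInternal x ∧ ¬ (𝓝 x).IsCountablyGenerated}

/-- `Q(f)` for a map `f : K → L`: the internal points of `L` whose fiber has more than one point. -/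
def internalNontrivial {K : Type u} {L : Type u} [LinearOrder L] [TopologicalSpace L]
    (f : K → L) : Set L :=
  {y | IsInternal y ∧ (f ⁻¹' {y}).Nontrivial}

end Points

/-- A subset of a partially ordered set is closed cofinal if every element lies below some
element of the subset and every increasing sequence of elements of the subset has
a supremum that belongs to the subset. -/
def IsClosedCofinal {P : Type u} [PartialOrder P] (F : Set P) : Prop :=
  (∀ p : P, ∃ q ∈ F, p ≤ q) ∧
    ∀ s : ℕ → P, Monotone s → (∀ n, s n ∈ F) → ∃ p ∈ F, IsLUB (Set.range s) p

/-- The metrizable quotients of `K`, viewed as equivalence relations on `K` (two continuous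
surjections from `K` are identified if they have the same fibers). -/
def MetrizableQuotient (K : Type u) [TopologicalSpace K] : Type u :=
  {r : Setoid K // TopologicalSpace.MetrizableSpace (Quotient r)}

/-- `q₁ ≤ q₂` if the equivalence relation of `q₂` is contained in that of `q₁`. -/
instance (K : Type u) [TopologicalSpace K] : PartialOrder (MetrizableQuotient K) :=
  PartialOrder.lift (fun q => OrderDual.toDual q.1) fun _ _ h => Subtype.ext h

/-- Typical quotient of `K` has property `P`: it holds on a closed cofinal set of
metrizable quotients. -/
def TypicalQuotient (K : Type u) [TopologicalSpace K] (P : MetrizableQuotient K → Prop) : Prop :=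
  ∃ F : Set (MetrizableQuotient K), IsClosedCofinal F ∧ ∀ q ∈ F, P q

/-- The quotient space of `q`, with the quotient topology. It is kept as a separate type
so that it carries no order inherited from `K`. -/
def MetrizableQuotient.Space {K : Type u} [TopologicalSpace K] (q : MetrizableQuotient K) :
    Type u :=
  Quotient q.1

instance {K : Type u} [TopologicalSpace K] (q : MetrizableQuotient K) :
    TopologicalSpace q.Space :=
  inferInstanceAs (TopologicalSpace (Quotient q.1))

/-- The quotient map onto the quotient space of `q`. -/
def MetrizableQuotient.proj {K : Type u} [TopologicalSpace K] (q : MetrizableQuotient K) :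
    K → q.Space :=
  Quotient.mk q.1

/-- `q` is order preserving: the quotient space carries a linear order which induces its
topology and makes the quotient map order preserving. -/
def MetrizableQuotient.IsOrderPreserving {K : Type u} [LinearOrder K] [TopologicalSpace K]
    (q : MetrizableQuotient K) : Prop :=
  ∃ _ : LinearOrder q.Space, OrderTopology q.Space ∧ Monotone q.proj

/-- The map `f : K → L` onto a line `L` is an order preserving continuous surjection which
represents the quotient `q`. -/
structure MetrizableQuotient.IsRepresentedBy {K L : Type u}
    [LinearOrder K] [TopologicalSpace K] [LinearOrder L] [TopologicalSpace L]
    (q : MetrizableQuotient K) (f : K → L) : Prop where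
  continuous : Continuous f
  monotone : Monotone f
  surjective : Function.Surjective f
  ker_eq : Setoid.ker f = q.1

end CompactLine

/-! A class of a metrizable quotient that contains a point of M(K) is never a singleton, since that
point would then have countable character. So typical quotients only have to preserve, at suitable
points z, the approach to z from both sides by points of lower order.

To each z in `level K (k + 1)` a family of pairs (u, v) with v in `level K k` is attached once and
for all, before any quotient is chosen (`exists_isWitnessFamily`). The intervals between u and v do
not overlap, so an increasing real function separates only countably many pairs. By
Stone–Weierstrass a metrizable quotient is determined by countably many such functions, so it too
separates only countably many. Hence only countably many points can be reached from countably many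
roots through separated pairs (`countable_visible`), and a single refinement resolves them all.

A point visible in the supremum of an increasing sequence is already visible at a finite stage. This
yields both closure under suprema and, by iterating refinements, cofinality
(`isClosedCofinal_resolving`). In a quotient resolving its own visible points, induction on k bounds
internal orders from below (`orderGE_of_mem_visible`). -/

namespace CompactLine

/-! ### Increasing continuous functions on a compact line -/

section MonotoneFunctions

variable {K : Type u} [LinearOrder K] [TopologicalSpace K] [OrderTopology K] [CompactSpace K]

/-- Points of a compact line are separated by continuous increasing real functions: the running
maximum of an Urysohn function is continuous. -/
theorem exists_monotone_continuous_lt {u v : K} (h : u < v) :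
    ∃ f : C(K, ℝ), Monotone f ∧ f u < f v := by
  obtain ⟨g, hg0, hg1, hg⟩ := exists_continuous_zero_one_of_isClosed (isClosed_Iic (a := u))
    (isClosed_Ici (a := v)) (Set.disjoint_left.2 fun x hx hx' => (h.trans_le hx').not_ge hx)
  have hbdd : ∀ x, BddAbove ((fun y => g (min x y)) '' Set.univ) := fun x =>
    ⟨1, by rintro _ ⟨y, -, rfl⟩; exact (hg _).2⟩
  -- Writing the maximum over (←, x] with `min x y` keeps the index set fixed and compact, so
  -- continuity in x follows.
  have hcont : Continuous fun x => sSup ((fun y => g (min x y)) '' Set.univ) :=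
    isCompact_univ.continuous_sSup (f := fun x y => g (min x y))
      (g.continuous.comp (continuous_fst.min continuous_snd))
  refine ⟨⟨_, hcont⟩, fun x x' hx => ?_, ?_⟩
  · refine csSup_le_csSup (hbdd x') ⟨_, x, trivial, rfl⟩ ?_
    rintro _ ⟨y, -, rfl⟩
    refine ⟨min x y, trivial, ?_⟩
    simp only
    rw [← min_assoc, min_eq_right hx]
  · have h0 : sSup ((fun y => g (min u y)) '' Set.univ) ≤ 0 := by
      refine csSup_le ⟨_, u, trivial, rfl⟩ ?_
      rintro _ ⟨y, -, rfl⟩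
      exact (hg0 (min_le_left u y)).le
    have h1 : (1 : ℝ) ≤ sSup ((fun y => g (min v y)) '' Set.univ) := by
      refine le_csSup (hbdd v) ⟨v, trivial, ?_⟩
      simpa using hg1 (Set.mem_Ici.2 le_rfl)
    exact (h0.trans_lt one_pos).trans_le h1

/-- Two sequences of increasing functions can be merged into one. -/
theorem exists_monotone_merge {X : Type u} [LinearOrder X] [TopologicalSpace X]
    {s t : ℕ → C(X, ℝ)} (hs : ∀ i, Monotone (s i)) (ht : ∀ i, Monotone (t i)) :
    ∃ r : ℕ → C(X, ℝ), (∀ i, Monotone (r i)) ∧ ∀ x y, (∀ i, r i x = r i y) →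
      (∀ i, s i x = s i y) ∧ ∀ i, t i x = t i y := by
  refine ⟨fun i => Sum.elim s t (Equiv.natSumNatEquivNat.symm i), fun i => ?_, fun x y h =>
    ⟨fun i => by simpa using h (Equiv.natSumNatEquivNat (Sum.inl i)),
      fun i => by simpa using h (Equiv.natSumNatEquivNat (Sum.inr i))⟩⟩
  simp only
  rcases Equiv.natSumNatEquivNat.symm i with j | j
  exacts [hs j, ht j]

variable (K) in
/-- The algebra of those continuous functions which are constant on the joint fibers of some
sequence of continuous increasing functions. -/
def monotoneDeterminedSubalgebra : Subalgebra ℝ C(K, ℝ) where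
  carrier := {g | ∃ t : ℕ → C(K, ℝ), (∀ i, Monotone (t i)) ∧
    ∀ x y, (∀ i, t i x = t i y) → g x = g y}
  mul_mem' := by
    rintro a b ⟨s, hs, ha⟩ ⟨t, ht, hb⟩
    obtain ⟨r, hr, hrst⟩ := exists_monotone_merge hs ht
    refine ⟨r, hr, fun x y h => ?_⟩
    simp [ha x y (hrst x y h).1, hb x y (hrst x y h).2]
  add_mem' := by
    rintro a b ⟨s, hs, ha⟩ ⟨t, ht, hb⟩
    obtain ⟨r, hr, hrst⟩ := exists_monotone_merge hs ht
    refine ⟨r, hr, fun x y h => ?_⟩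
    simp [ha x y (hrst x y h).1, hb x y (hrst x y h).2]
  algebraMap_mem' := fun r => ⟨fun _ => 0, fun _ _ _ _ => le_rfl, fun _ _ _ => rfl⟩

/-- Every continuous function on a compact line is constant on the joint fibers of some sequence
of continuous increasing functions. -/
theorem exists_monotone_determining (g : C(K, ℝ)) :
    ∃ t : ℕ → C(K, ℝ), (∀ i, Monotone (t i)) ∧ ∀ x y, (∀ i, t i x = t i y) → g x = g y := by
  have hsep : (monotoneDeterminedSubalgebra K).SeparatesPoints := by
    intro x y hxy
    wlog h : x < y generalizing x y
    · obtain ⟨f, hf, hne⟩ := this hxy.symm (lt_of_le_of_ne (not_lt.1 h) hxy.symm)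
      exact ⟨f, hf, hne.symm⟩
    obtain ⟨f, hf, hlt⟩ := exists_monotone_continuous_lt h
    exact ⟨f, ⟨f, ⟨fun _ => f, fun _ => hf, fun _ _ h => h 0⟩, rfl⟩, hlt.ne⟩
  -- Stone–Weierstrass gives density. The determining sequences of the approximants, merged by
  -- `Nat.unpair`, also determine the limit.
  have hg : g ∈ (monotoneDeterminedSubalgebra K).topologicalClosure := by
    rw [ContinuousMap.subalgebra_topologicalClosure_eq_top_of_separatesPoints _ hsep]
    trivial
  obtain ⟨s, hs, hlim⟩ := mem_closure_iff_seq_limit.1 hg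
  choose t ht hst using hs
  refine ⟨fun i => t i.unpair.1 i.unpair.2, fun i => ht _ _, fun x y h => ?_⟩
  have hxy : ∀ n, s n x = s n y := fun n => hst n x y fun i => by
    simpa using h (Nat.pair n i)
  have hx := ((continuous_eval_const (F := C(K, ℝ)) x).tendsto g).comp hlim
  have hy := ((continuous_eval_const (F := C(K, ℝ)) y).tendsto g).comp hlim
  refine tendsto_nhds_unique hx (hy.congr fun n => ?_)
  exact (hxy n).symm

end MonotoneFunctions

/-! ### Metrizable quotients and their countable suprema -/

section Quotients

variable {K : Type u} [TopologicalSpace K]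

theorem MetrizableQuotient.continuous_proj (q : MetrizableQuotient K) : Continuous q.proj :=
  continuous_quotient_mk'

theorem MetrizableQuotient.proj_eq_iff (q : MetrizableQuotient K) {x y : K} :
    q.proj x = q.proj y ↔ q.1 x y :=
  Quotient.eq (r := q.1)

instance (q : MetrizableQuotient K) : TopologicalSpace.MetrizableSpace q.Space := q.2

theorem MetrizableQuotient.le_iff {p q : MetrizableQuotient K} :
    p ≤ q ↔ ∀ x y, q.1 x y → p.1 x y :=
  ⟨fun h x y => @h x y, fun h x y => h x y⟩

variable [CompactSpace K]

instance (q : MetrizableQuotient K) : CompactSpace q.Space :=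
  inferInstanceAs (CompactSpace (Quotient q.1))

/-- The metrizable quotient given by the fibers of a continuous map to a metrizable space. -/
def MetrizableQuotient.ofMap {Y : Type*} [TopologicalSpace Y] [TopologicalSpace.MetrizableSpace Y]
    (g : K → Y) (hg : Continuous g) : MetrizableQuotient K :=
  ⟨Setoid.ker g,
    ((hg.quotient_lift fun _ _ h => h).isClosedEmbedding
      (Setoid.kerLift_injective g)).isEmbedding.metrizableSpace⟩

/-- The joint refinement of a sequence of metrizable quotients. -/
def MetrizableQuotient.iSup (s : ℕ → MetrizableQuotient K) : MetrizableQuotient K :=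
  .ofMap (fun x n => (s n).proj x) (continuous_pi fun n => (s n).continuous_proj)

theorem MetrizableQuotient.iSup_rel (s : ℕ → MetrizableQuotient K) {x y : K} :
    (MetrizableQuotient.iSup s).1 x y ↔ ∀ n, (s n).1 x y := by
  simp only [← MetrizableQuotient.proj_eq_iff]
  rw [MetrizableQuotient.proj_eq_iff]
  exact funext_iff

theorem MetrizableQuotient.isLUB_iSup (s : ℕ → MetrizableQuotient K) :
    IsLUB (Set.range s) (MetrizableQuotient.iSup s) := by
  constructor
  · rintro _ ⟨n, rfl⟩
    exact MetrizableQuotient.le_iff.2 fun x y h => (MetrizableQuotient.iSup_rel s).1 h n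
  · intro p hp
    exact MetrizableQuotient.le_iff.2 fun x y h => (MetrizableQuotient.iSup_rel s).2 fun n =>
      MetrizableQuotient.le_iff.1 (hp ⟨n, rfl⟩) x y h

/-- If a point is the only point of its class in a metrizable quotient, it has
countable character. -/
theorem MetrizableQuotient.isCountablyGenerated_nhds (q : MetrizableQuotient K) {z : K}
    (h : ∀ w, q.1 w z → w = z) : (𝓝 z).IsCountablyGenerated := by
  have hz : q.proj ⁻¹' {q.proj z} = {z} :=
    Set.eq_singleton_iff_unique_mem.2 ⟨rfl, fun w hw => h w (q.proj_eq_iff.1 hw)⟩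
  -- For a closed map, neighbourhoods of a point pull back to a base at its fiber, here `{z}`.
  have := q.continuous_proj.isClosedMap.comap_nhds_eq q.continuous_proj (q.proj z)
  rw [hz, nhdsSet_singleton] at this
  rw [← this]
  infer_instance

end Quotients

/-! ### Convex quotients are order preserving and cofinal -/

section OrderedQuotients

variable {K : Type u} [LinearOrder K] [TopologicalSpace K] [OrderTopology K] [CompactSpace K]

/-- An increasing quotient map from a compact line onto a linearly ordered Hausdorff space
forces the topology to be the order topology. -/
theorem orderTopology_of_isQuotientMap {L : Type*} [LinearOrder L] [t : TopologicalSpace L]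
    [T2Space L] {f : K → L} (hq : IsQuotientMap f) (hf : Monotone f) : OrderTopology L := by
  have hfib : ∀ a : L, IsCompact (f ⁻¹' {a}) := fun a =>
    (isClosed_singleton.preimage hq.continuous).isCompact
  have hne : ∀ a : L, (f ⁻¹' {a}).Nonempty := fun a => hq.surjective a
  have hle : t ≤ Preorder.topology L := by
    rw [Preorder.topology]
    refine le_generateFrom ?_
    rintro _ ⟨a, rfl | rfl⟩
    · obtain ⟨b, hb, hmax⟩ := (hfib a).exists_isGreatest (hne a)
      rw [← hq.isOpen_preimage]
      convert isOpen_Ioi (a := b) using 1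
      ext x
      simp only [Set.mem_preimage, Set.mem_Ioi]
      rw [← (show f b = a from hb)]
      refine ⟨fun h => hf.reflect_lt h, fun h => lt_of_le_of_ne (hf h.le) fun he => ?_⟩
      exact (hmax (show f x = a from he.symm.trans hb)).not_gt h
    · obtain ⟨b, hb, hmin⟩ := (hfib a).exists_isLeast (hne a)
      rw [← hq.isOpen_preimage]
      convert isOpen_Iio (a := b) using 1
      ext x
      simp only [Set.mem_preimage, Set.mem_Iio]
      rw [← (show f b = a from hb)]
      refine ⟨fun h => hf.reflect_lt h, fun h => lt_of_le_of_ne (hf h.le) fun he => ?_⟩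
      exact (hmin (show f x = a from he.trans hb)).not_gt h
  have hcomp : @CompactSpace L t := ⟨by
    rw [← hq.surjective.range_eq]
    exact isCompact_range hq.continuous⟩
  refine ⟨?_⟩
  -- The identity from the compact topology `t` to the coarser Hausdorff order topology is a
  -- homeomorphism.
  have ht2 : @T2Space L (Preorder.topology L) :=
    @OrderClosedTopology.to_t2Space L (Preorder.topology L) _
      (@OrderTopology.to_orderClosedTopology L (Preorder.topology L) _
        (@OrderTopology.mk L (Preorder.topology L) _ rfl))
  obtain ⟨⟨⟨hind⟩, -⟩, -⟩ := @Continuous.isClosedEmbedding L L t (Preorder.topology L) hcomp ht2 id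
    ((@continuous_id_iff_le L t (Preorder.topology L)).2 hle) Function.injective_id
  exact hind.trans (@induced_id L (Preorder.topology L))

/-- The classes of the equivalence relation are order-convex. -/
def MetrizableQuotient.IsConvex (q : MetrizableQuotient K) : Prop :=
  ∀ ⦃x y z : K⦄, x ≤ y → y ≤ z → q.1 x z → q.1 x y

theorem MetrizableQuotient.IsConvex.isOrderPreserving {q : MetrizableQuotient K}
    (hq : q.IsConvex) : q.IsOrderPreserving := by
  classical
  have H : ∀ x : Quotient q.1, Set.OrdConnected (Quotient.mk q.1 ⁻¹' {x}) := by
    refine fun c => ⟨fun x hx z hz y hy => ?_⟩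
    simp only [Set.mem_preimage, Set.mem_singleton_iff] at hx hz ⊢
    rw [← hx] at hz ⊢
    exact (Quotient.sound (s := q.1) (hq hy.1 hy.2 (Quotient.exact hz.symm))).symm
  let o : LinearOrder (Quotient q.1) := Quotient.instLinearOrder
  have hm : Monotone (Quotient.mk q.1) := Quotient.mk_monotone
  have : TopologicalSpace.MetrizableSpace (Quotient q.1) := q.2
  have ho : OrderTopology (Quotient q.1) :=
    orderTopology_of_isQuotientMap isQuotientMap_quotient_mk' hm
  exact ⟨o, ho, hm⟩

/-- Every metrizable quotient is determined by a sequence of continuous increasing functions. -/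
theorem MetrizableQuotient.exists_monotone_determining (q : MetrizableQuotient K) :
    ∃ t : ℕ → C(K, ℝ), (∀ i, Monotone (t i)) ∧ ∀ x y, (∀ i, t i x = t i y) → q.1 x y := by
  rcases isEmpty_or_nonempty K with hK | hK
  · exact ⟨fun _ => 0, fun _ _ _ _ => le_rfl, fun x => hK.elim x⟩
  let _ := TopologicalSpace.metrizableSpaceMetric q.Space
  have : Nonempty q.Space := hK.map q.proj
  obtain ⟨d, hd⟩ := TopologicalSpace.exists_dense_seq q.Space
  -- The distances to a dense sequence determine a point of the quotient.
  let g : ℕ → C(K, ℝ) := fun n =>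
    ⟨fun x => dist (q.proj x) (d n), q.continuous_proj.dist continuous_const⟩
  choose t ht htg using fun n => CompactLine.exists_monotone_determining (g n)
  refine ⟨fun i => t i.unpair.1 i.unpair.2, fun i => ht _ _, fun x y h => ?_⟩
  have hxy : ∀ n, dist (q.proj x) (d n) = dist (q.proj y) (d n) := fun n =>
    htg n x y fun i => by simpa using h (Nat.pair n i)
  refine q.proj_eq_iff.1 ?_
  have hfun : (fun c => dist (q.proj x) c) = fun c => dist (q.proj y) c :=
    hd.equalizer (continuous_const.dist continuous_id) (continuous_const.dist continuous_id)
      (funext hxy)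
  have := congrFun hfun (q.proj y)
  simpa using this

/-- A metrizable quotient can be refined to a convex one which in addition separates countably
many given pairs of points. -/
theorem MetrizableQuotient.exists_convex_refinement (q : MetrizableQuotient K)
    {T : Set (K × K)} (hT : T.Countable) (hne : ∀ P ∈ T, P.1 ≠ P.2) :
    ∃ q' : MetrizableQuotient K, q ≤ q' ∧ q'.IsConvex ∧ ∀ P ∈ T, ¬ q'.1 P.1 P.2 := by
  obtain ⟨t, ht, htq⟩ := q.exists_monotone_determining
  have hsep : ∀ P : T, ∃ f : C(K, ℝ), Monotone f ∧ f P.1.1 ≠ f P.1.2 := by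
    rintro ⟨P, hP⟩
    rcases lt_or_gt_of_ne (hne P hP) with h | h
    · obtain ⟨f, hf, hlt⟩ := exists_monotone_continuous_lt h
      exact ⟨f, hf, hlt.ne⟩
    · obtain ⟨f, hf, hlt⟩ := exists_monotone_continuous_lt h
      exact ⟨f, hf, hlt.ne'⟩
  choose s hs hsne using hsep
  have := hT.to_subtype
  let F : ℕ ⊕ T → C(K, ℝ) := Sum.elim t s
  have hF : ∀ i, Monotone (F i) := by rintro (i | i); exacts [ht i, hs i]
  refine ⟨.ofMap (fun x i => F i x) (continuous_pi fun i => (F i).continuous), ?_, ?_, ?_⟩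
  · refine MetrizableQuotient.le_iff.2 fun x y h => htq x y fun i => ?_
    exact congrFun (Setoid.ker_def.1 h) (Sum.inl i)
  · intro x y z hxy hyz h
    refine Setoid.ker_def.2 (funext fun i => le_antisymm (hF i hxy) ?_)
    exact (hF i hyz).trans (congrFun (Setoid.ker_def.1 h) i).ge
  · intro P hP h
    exact hsne ⟨P, hP⟩ (congrFun (Setoid.ker_def.1 h) (Sum.inr ⟨P, hP⟩))

end OrderedQuotients

/-! ### Non-overlapping families of pairs accumulating at a point -/

section WitnessFamilies

variable {K : Type u} [LinearOrder K]

/-- `v` lies strictly between `w` and `z`. -/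
def Between (w v z : K) : Prop := (w < v ∧ v < z) ∨ (z < v ∧ v < w)

theorem Between.of_approach {w w' v z : K}
    (h : (w ≤ w' ∧ w' < z) ∨ (z < w' ∧ w' ≤ w)) (hb : Between w' v z) : Between w v z := by
  rcases h with ⟨h1, h2⟩ | ⟨h1, h2⟩ <;> rcases hb with ⟨h3, h4⟩ | ⟨h3, h4⟩
  · exact Or.inl ⟨h1.trans_lt h3, h4⟩
  · exact absurd (h3.trans h4) h2.asymm
  · exact absurd (h3.trans h4) h1.asymm
  · exact Or.inr ⟨h3, h4.trans_le h2⟩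

theorem Between.ne_left {w v z : K} (h : Between w v z) : w ≠ v := by
  rcases h with h | h
  exacts [h.1.ne, h.2.ne']

theorem Between.ne_right {w v z : K} (h : Between w v z) : v ≠ z := by
  rcases h with h | h
  exacts [h.2.ne, h.1.ne']

/-- A family `S` of pairs `(u, v)` with `v ∈ A`, lying on both sides of `z` and accumulating at `z`,
such that every increasing real function separates only countably many of these pairs. -/
structure IsWitnessFamily (A : Set K) (z : K) (S : Set (K × K)) : Prop where
  mem : ∀ P ∈ S, P.2 ∈ A
  exists_between : ∀ w, w ≠ z → ∃ P ∈ S, Between w P.1 z ∧ Between P.1 P.2 z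
  countable : ∀ f : K → ℝ, Monotone f → {P ∈ S | f P.1 ≠ f P.2}.Countable

/-- A point approached by `A` from the left is approached by non-overlapping intervals with right
end points in `A`. -/
theorem exists_nonoverlapping_family {A : Set K} {z : K}
    (h : ∀ w < z, ∃ y ∈ A, w < y ∧ y < z) :
    ∃ S : Set (K × K), (∀ P ∈ S, P.1 < P.2 ∧ P.2 < z ∧ P.2 ∈ A) ∧
      (S.Pairwise fun P P' => P.2 ≤ P'.1 ∨ P'.2 ≤ P.1) ∧ ∀ w < z, ∃ P ∈ S, w < P.1 := by
  obtain ⟨S, ⟨hS, hpair⟩, hmax⟩ := zorn_subset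
    {S : Set (K × K) | (∀ P ∈ S, P.1 < P.2 ∧ P.2 < z ∧ P.2 ∈ A) ∧
      S.Pairwise fun P P' => P.2 ≤ P'.1 ∨ P'.2 ≤ P.1} (by
    refine fun c hc hchain => ⟨⋃₀ c, ⟨?_, ?_⟩, fun s hs => Set.subset_sUnion_of_mem hs⟩
    · rintro P ⟨s, hs, hP⟩
      exact (hc hs).1 P hP
    · exact (Set.pairwise_sUnion hchain.directedOn).2 fun s hs => (hc hs).2)
  refine ⟨S, hS, hpair, fun w hw => ?_⟩
  by_contra! hcon
  -- If all left end points are at most w, at most one pair reaches beyond w. Its right end point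
  -- bounds the family below z, leaving room for a further pair, against maximality.
  obtain ⟨w', hww', hw'z, hw'⟩ : ∃ w', w ≤ w' ∧ w' < z ∧ ∀ P ∈ S, P.2 ≤ w' := by
    by_cases hP : ∃ P ∈ S, w < P.2
    · obtain ⟨P, hPS, hP⟩ := hP
      refine ⟨P.2, hP.le, (hS P hPS).2.1, fun P' hP' => ?_⟩
      rcases eq_or_ne P' P with rfl | hne
      · exact le_rfl
      · rcases hpair hP' hPS hne with h1 | h1
        · exact h1.trans (hS P hPS).1.le
        · exact absurd (hcon P' hP') (not_le.2 (hP.trans_le h1))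
    · push Not at hP
      exact ⟨w, le_rfl, hw, hP⟩
  obtain ⟨u, -, hu, huz⟩ := h w' hw'z
  obtain ⟨v, hvA, huv, hvz⟩ := h u huz
  have hins : insert (u, v) S ⊆ S := by
    refine hmax ⟨?_, ?_⟩ (Set.subset_insert _ _)
    · rintro P (rfl | hP)
      · exact ⟨huv, hvz, hvA⟩
      · exact hS P hP
    · refine hpair.insert fun P hP _ => ?_
      have := (hw' P hP).trans hu.le
      exact ⟨Or.inr this, Or.inl this⟩
  exact (hcon _ (hins (Set.mem_insert _ _))).not_gt (hww'.trans_lt hu)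

/-- The separated pairs (u, v) yield disjoint nonempty open intervals (f u, f v) of ℝ, of which
there are only countably many. -/
theorem exists_left_family {A : Set K} {z : K} (h : ∀ w < z, ∃ y ∈ A, w < y ∧ y < z) :
    ∃ S : Set (K × K), (∀ P ∈ S, P.1 < P.2 ∧ P.2 < z ∧ P.2 ∈ A) ∧
      (∀ w < z, ∃ P ∈ S, w < P.1) ∧
      ∀ f : K → ℝ, Monotone f → {P ∈ S | f P.1 ≠ f P.2}.Countable := by
  obtain ⟨S, hS, hpair, hcof⟩ := exists_nonoverlapping_family h
  refine ⟨S, hS, hcof, fun f hf => ?_⟩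
  refine Set.PairwiseDisjoint.countable_of_isOpen (s := fun P : K × K => Set.Ioo (f P.1) (f P.2))
    ?_ (fun _ _ => isOpen_Ioo) fun P hP => Set.nonempty_Ioo.2 ?_
  · intro P hP P' hP' hne
    refine Set.disjoint_left.2 fun a ha ha' => ?_
    rcases hpair hP.1 hP'.1 hne with h1 | h1
    · exact ((ha.2.trans_le (hf h1)).trans ha'.1).false
    · exact ((ha'.2.trans_le (hf h1)).trans ha.1).false
  · exact lt_of_le_of_ne (hf (hS P hP.1).1.le) hP.2

/-- A point approached by `A` from both sides has a witness family. -/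
theorem exists_isWitnessFamily {A : Set K} {z : K} (hl : ∀ w < z, ∃ y ∈ A, w < y ∧ y < z)
    (hr : ∀ w, z < w → ∃ y ∈ A, z < y ∧ y < w) : ∃ S, IsWitnessFamily A z S := by
  obtain ⟨S, hS, hScof, hSc⟩ := exists_left_family hl
  obtain ⟨T, hT, hTcof, hTc⟩ := exists_left_family (K := Kᵒᵈ) (A := OrderDual.ofDual ⁻¹' A)
    (z := OrderDual.toDual z) fun w hw => by
      obtain ⟨y, hyA, hzy, hyw⟩ := hr (OrderDual.ofDual w) hw
      exact ⟨OrderDual.toDual y, hyA, hyw, hzy⟩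
  refine ⟨S ∪ (Prod.map OrderDual.toDual OrderDual.toDual) ⁻¹' T, ?_, ?_, ?_⟩
  · rintro P (hP | hP)
    · exact (hS P hP).2.2
    · exact (hT _ hP).2.2
  · intro w hw
    rcases lt_or_gt_of_ne hw with hlt | hgt
    · obtain ⟨P, hP, hwP⟩ := hScof w hlt
      obtain ⟨h1, h2, -⟩ := hS P hP
      exact ⟨P, Or.inl hP, Or.inl ⟨hwP, h1.trans h2⟩, Or.inl ⟨h1, h2⟩⟩
    · obtain ⟨P, hP, hwP⟩ := hTcof (OrderDual.toDual w) hgt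
      obtain ⟨h1, h2, -⟩ := hT P hP
      exact ⟨(OrderDual.ofDual P.1, OrderDual.ofDual P.2), Or.inr hP,
        Or.inr ⟨h1.trans h2, hwP⟩, Or.inr ⟨h2, h1⟩⟩
  · intro f hf
    have hc := hTc (fun x => -f (OrderDual.ofDual x)) fun x y hxy => neg_le_neg (hf hxy)
    refine ((hSc f hf).union (hc.preimage (f := Prod.map OrderDual.toDual OrderDual.toDual)
      (OrderDual.toDual.injective.prodMap OrderDual.toDual.injective))).mono ?_
    rintro P ⟨hP | hP, hne⟩
    · exact Or.inl ⟨hP, hne⟩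
    · exact Or.inr ⟨hP, fun he => hne (neg_injective he)⟩

end WitnessFamilies

/-! ### Levels of M(K) -/

section Levels

variable {K : Type u} [LinearOrder K] [TopologicalSpace K]

variable (K) in
/-- `level K 0` is the whole line and `level K (n + 1)` consists of the points of `M(K)` that are
approached by `level K n` from both sides. -/
def level : ℕ → Set K
  | 0 => Set.univ
  | n + 1 => {z | z ∈ internalUncountable K ∧ (∀ w < z, ∃ y ∈ level n, w < y ∧ y < z) ∧
      ∀ w, z < w → ∃ y ∈ level n, z < y ∧ y < w}

theorem IsInternal.exists_lt {z : K} (hz : IsInternal z) : ∃ w, w < z := by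
  have := not_or.1 hz
  obtain ⟨w, hw⟩ := Filter.nonempty_of_mem (hf := ⟨this.2⟩) (self_mem_nhdsWithin (s := Set.Iio z))
  exact ⟨w, hw⟩

theorem IsInternal.exists_gt {z : K} (hz : IsInternal z) : ∃ w, z < w := by
  have := not_or.1 hz
  obtain ⟨w, hw⟩ := Filter.nonempty_of_mem (hf := ⟨this.1⟩) (self_mem_nhdsWithin (s := Set.Ioi z))
  exact ⟨w, hw⟩

theorem OrderGE.mem {X : Type u} [LinearOrder X] {A : Set X} {n : ℕ} {x : X}
    (h : OrderGE A n x) : x ∈ A := by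
  cases n with
  | zero => exact h
  | succ n => exact h.1

/-- The index shifts by one because level 0 is the whole line: level 1 is M(K), internality
supplying the approach from both sides. -/
theorem mem_level_of_orderGE [OrderTopology K] {n : ℕ} {z : K}
    (h : OrderGE (internalUncountable K) n z) : z ∈ level K (n + 1) := by
  induction n generalizing z with
  | zero =>
    have hz : z ∈ internalUncountable K := h
    have hne := not_or.1 hz.1
    refine ⟨hz, fun w hw => ?_, fun w hw => ?_⟩
    · obtain ⟨y, hy⟩ := Filter.nonempty_of_mem (hf := ⟨hne.2⟩) (Ioo_mem_nhdsLT hw)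
      exact ⟨y, trivial, hy⟩
    · obtain ⟨y, hy⟩ := Filter.nonempty_of_mem (hf := ⟨hne.1⟩) (Ioo_mem_nhdsGT hw)
      exact ⟨y, trivial, hy⟩
  | succ n ih =>
    obtain ⟨hz, -, -, hlub, hglb⟩ := h
    refine ⟨hz, fun w hw => ?_, fun w hw => ?_⟩
    · obtain ⟨y, hy, hwy⟩ := (lt_isLUB_iff hlub).1 hw
      exact ⟨y, ih hy.2.2, hwy, hy.2.1⟩
    · obtain ⟨y, hy, hwy⟩ := (isGLB_lt_iff hglb).1 hw
      exact ⟨y, ih hy.2.2, hy.2.1, hwy⟩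

end Levels

/-! ### Visible points and the closed cofinal set of resolving quotients -/

section Visible

variable {K : Type u}

/-- The pairs (level, point) reached in `d` steps from the roots `R`, where one may step from
`(k + 1, z)` to `(k, v)` if `(u, v)` is in the family of `(k, z)` and the equivalence relation
separates `u` from `v` and `v` from `z`. -/
def visible (S : ℕ → K → Set (K × K)) (R : Set (ℕ × K)) (r : Setoid K) : ℕ → Set (ℕ × K)
  | 0 => R
  | d + 1 => {c | ∃ z, (c.1 + 1, z) ∈ visible S R r d ∧
      ∃ P ∈ S c.1 z, P.2 = c.2 ∧ ¬ r P.1 P.2 ∧ ¬ r P.2 z}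

variable {S : ℕ → K → Set (K × K)} {R : Set (ℕ × K)}

theorem visible_mono {r r' : Setoid K} (hr : r' ≤ r) (d : ℕ) :
    visible S R r d ⊆ visible S R r' d := by
  induction d with
  | zero => exact subset_rfl
  | succ d ih =>
    rintro c ⟨z, hz, P, hP, hPc, h1, h2⟩
    exact ⟨z, ih hz, P, hP, hPc, fun h => h1 (hr h), fun h => h2 (hr h)⟩

/-- A path of d steps uses finitely many separations; each happens at some stage and persists
afterwards. -/
theorem exists_mem_visible_of_iSup [TopologicalSpace K] [CompactSpace K]
    {s : ℕ → MetrizableQuotient K} (hs : Monotone s) {d : ℕ} {c : ℕ × K}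
    (hc : c ∈ visible S R (MetrizableQuotient.iSup s).1 d) :
    ∃ n, c ∈ visible S R (s n).1 d := by
  induction d generalizing c with
  | zero => exact ⟨0, hc⟩
  | succ d ih =>
    obtain ⟨z, hz, P, hP, hPc, h1, h2⟩ := hc
    obtain ⟨n, hn⟩ := ih hz
    rw [MetrizableQuotient.iSup_rel, not_forall] at h1 h2
    obtain ⟨n1, hn1⟩ := h1
    obtain ⟨n2, hn2⟩ := h2
    have key : ∀ {i j : ℕ}, i ≤ j → (s j).1 ≤ (s i).1 := fun hij => hs hij
    refine ⟨max n (max n1 n2), z, visible_mono (key (le_max_left _ _)) d hn, P, hP, hPc,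
      fun h => hn1 (key ?_ h), fun h => hn2 (key ?_ h)⟩
    · exact (le_max_left _ _).trans (le_max_right _ _)
    · exact (le_max_right _ _).trans (le_max_right _ _)

variable [LinearOrder K]

/-- Every point which `r` separates from `z` is cut off from `z` by a pair of the family that is
separated by `r'`, and the class of `z` under `r'` is not extremal. -/
def Resolves (S : ℕ → K → Set (K × K)) (r r' : Setoid K) (k : ℕ) (z : K) : Prop :=
  (∀ w, ¬ r w z → ∃ P ∈ S k z,
    Between w P.1 z ∧ Between P.1 P.2 z ∧ ¬ r' P.1 P.2 ∧ ¬ r' P.2 z) ∧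
  (∃ w < z, ¬ r' w z) ∧ ∃ w, z < w ∧ ¬ r' w z

theorem Resolves.mono {r r' r'' : Setoid K} {k : ℕ} {z : K} (h : Resolves S r r' k z)
    (hr : r'' ≤ r') : Resolves S r r'' k z := by
  obtain ⟨h1, ⟨w, hw, hwz⟩, ⟨w', hw', hwz'⟩⟩ := h
  refine ⟨fun w hw => ?_, ⟨w, hw, fun h => hwz (hr h)⟩, ⟨w', hw', fun h => hwz' (hr h)⟩⟩
  obtain ⟨P, hP, hb, hb', hn, hn'⟩ := h1 w hw
  exact ⟨P, hP, hb, hb', fun h => hn (hr h), fun h => hn' (hr h)⟩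

variable [TopologicalSpace K]

theorem visible_subset_level (hR : ∀ c ∈ R, c.2 ∈ level K c.1)
    (hS : ∀ k, ∀ z ∈ level K (k + 1), IsWitnessFamily (level K k) z (S k z)) (r : Setoid K)
    {d : ℕ} {c : ℕ × K} (hc : c ∈ visible S R r d) : c.2 ∈ level K c.1 := by
  induction d generalizing c with
  | zero => exact hR c hc
  | succ d ih =>
    obtain ⟨z, hz, P, hP, hPc, -, -⟩ := hc
    rw [← hPc]
    exact (hS c.1 z (ih hz)).mem P hP

variable [CompactSpace K]

/-- If each quotient of an increasing sequence resolves the visible points of its predecessor, then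
the supremum resolves its own visible points. -/
theorem resolves_iSup {s : ℕ → MetrizableQuotient K} (hs : Monotone s)
    (h : ∀ n d k z, (k + 1, z) ∈ visible S R (s n).1 d → Resolves S (s n).1 (s (n + 1)).1 k z)
    {d k : ℕ} {z : K} (hz : (k + 1, z) ∈ visible S R (MetrizableQuotient.iSup s).1 d) :
    Resolves S (MetrizableQuotient.iSup s).1 (MetrizableQuotient.iSup s).1 k z := by
  obtain ⟨n, hn⟩ := exists_mem_visible_of_iSup hs hz
  have key : ∀ {i j : ℕ}, i ≤ j → (s j).1 ≤ (s i).1 := fun hij => hs hij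
  have hle : ∀ m, (MetrizableQuotient.iSup s).1 ≤ (s m).1 := fun m _ _ hxy =>
    (MetrizableQuotient.iSup_rel s).1 hxy m
  -- Once visible, z is resolved anew at every later stage, so each w separated from z at any stage
  -- is eventually dealt with.
  have hres : ∀ m, n ≤ m → Resolves S (s m).1 (MetrizableQuotient.iSup s).1 k z := fun m hm =>
    (h m d k z (visible_mono (key hm) d hn)).mono (hle _)
  refine ⟨fun w hw => ?_, (hres n le_rfl).2⟩
  rw [MetrizableQuotient.iSup_rel, not_forall] at hw
  obtain ⟨m, hm⟩ := hw
  exact (hres (max n m) (le_max_left _ _)).1 w fun h => hm (key (le_max_right n m) h)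

variable [OrderTopology K]

/-- Each visible point has countably many successors, as countably many increasing functions
determine the quotient and each separates countably many pairs of a witness family. -/
theorem countable_visible (hRc : R.Countable) (hR : ∀ c ∈ R, c.2 ∈ level K c.1)
    (hS : ∀ k, ∀ z ∈ level K (k + 1), IsWitnessFamily (level K k) z (S k z))
    (q : MetrizableQuotient K) (d : ℕ) : (visible S R q.1 d).Countable := by
  induction d with
  | zero => exact hRc
  | succ d ih =>
    obtain ⟨t, ht, htq⟩ := q.exists_monotone_determining
    have hfam : ∀ k, ∀ z ∈ level K (k + 1), {P ∈ S k z | ¬ q.1 P.1 P.2}.Countable := by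
      intro k z hz
      refine (Set.countable_iUnion fun i => (hS k z hz).countable (t i) (ht i)).mono ?_
      rintro P ⟨hP, hn⟩
      by_contra hcon
      simp only [Set.mem_iUnion, not_exists] at hcon
      exact hn (htq _ _ fun i => by_contra fun hne => hcon i ⟨hP, hne⟩)
    have hstep : ∀ c ∈ visible S R q.1 d,
        {b : ℕ × K | b.1 + 1 = c.1 ∧ ∃ P ∈ S b.1 c.2, P.2 = b.2 ∧ ¬ q.1 P.1 P.2}.Countable := by
      rintro ⟨k, z⟩ hc
      rcases k with _ | k
      · simp
      · refine ((hfam k z (visible_subset_level hR hS q.1 hc)).image fun P => (k, P.2)).mono ?_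
        rintro ⟨k', v⟩ ⟨hk, P, hP, hPv, hn⟩
        obtain rfl : k' = k := by simpa using hk
        exact ⟨P, ⟨hP, hn⟩, by simpa using hPv⟩
    refine (ih.biUnion hstep).mono ?_
    rintro c ⟨z, hz, P, hP, hPc, h1, -⟩
    exact Set.mem_biUnion hz ⟨rfl, P, hP, hPc, h1⟩

/-- In a metrizable quotient of a compact line, the points not equivalent to `z` are
approached towards `z` by countably many of them. -/
theorem MetrizableQuotient.exists_countable_approach (q : MetrizableQuotient K) (z : K) :
    ∃ W : Set K, W.Countable ∧ (∀ w ∈ W, w ≠ z) ∧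
      ∀ w, ¬ q.1 w z → ∃ w' ∈ W, (w ≤ w' ∧ w' < z) ∨ (z < w' ∧ w' ≤ w) := by
  let _ := TopologicalSpace.metrizableSpaceMetric q.Space
  -- The complement of a point in a metrizable space is an F_σ. Each closed piece has a compact
  -- preimage, whose points nearest to z on either side form W.
  obtain ⟨F, hF, hFsub, hFU, -⟩ := (isClosed_singleton (x := q.proj z)).isOpen_compl
    |>.exists_iUnion_isClosed
  have hcl : ∀ n, IsClosed (q.proj ⁻¹' F n) := fun n => (hF n).preimage q.continuous_proj
  have hne : ∀ n, ∀ w ∈ q.proj ⁻¹' F n, w ≠ z := by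
    rintro n w hw rfl
    exact hFsub n hw rfl
  refine ⟨⋃ n, ({w | IsGreatest (q.proj ⁻¹' F n ∩ Set.Iic z) w} ∪
    {w | IsLeast (q.proj ⁻¹' F n ∩ Set.Ici z) w}), ?_, ?_, ?_⟩
  · refine Set.countable_iUnion fun n => Set.Countable.union ?_ ?_
    · exact Set.Subsingleton.countable fun a ha b hb => ha.unique hb
    · exact Set.Subsingleton.countable fun a ha b hb => ha.unique hb
  · intro w hw
    obtain ⟨n, hn | hn⟩ := Set.mem_iUnion.1 hw
    · exact hne n w hn.1.1
    · exact hne n w hn.1.1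
  · intro w hw
    have hwU : q.proj w ∈ ⋃ n, F n := by
      rw [hFU]
      exact fun h => hw (q.proj_eq_iff.1 h)
    obtain ⟨n, hn⟩ := Set.mem_iUnion.1 hwU
    rcases le_total w z with hwz | hwz
    · obtain ⟨w', hw'⟩ := ((hcl n).inter isClosed_Iic).isCompact.exists_isGreatest ⟨w, hn, hwz⟩
      exact ⟨w', Set.mem_iUnion.2 ⟨n, Or.inl hw'⟩,
        Or.inl ⟨hw'.2 ⟨hn, hwz⟩, lt_of_le_of_ne hw'.1.2 (hne n w' hw'.1.1)⟩⟩
    · obtain ⟨w', hw'⟩ := ((hcl n).inter isClosed_Ici).isCompact.exists_isLeast ⟨w, hn, hwz⟩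
      exact ⟨w', Set.mem_iUnion.2 ⟨n, Or.inr hw'⟩,
        Or.inr ⟨lt_of_le_of_ne hw'.1.2 (hne n w' hw'.1.1).symm, hw'.2 ⟨hn, hwz⟩⟩⟩

/-- To resolve a point it suffices to separate countably many pairs. -/
theorem MetrizableQuotient.exists_countable_resolving (q : MetrizableQuotient K) {k : ℕ} {z : K}
    (hz : z ∈ level K (k + 1)) (hS : IsWitnessFamily (level K k) z (S k z)) :
    ∃ T : Set (K × K), T.Countable ∧ (∀ P ∈ T, P.1 ≠ P.2) ∧
      ∀ r' : Setoid K, (∀ P ∈ T, ¬ r' P.1 P.2) → Resolves S q.1 r' k z := by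
  obtain ⟨W, hWc, hWne, hW⟩ := q.exists_countable_approach z
  obtain ⟨a, ha⟩ := hz.1.1.exists_lt
  obtain ⟨b, hb⟩ := hz.1.1.exists_gt
  choose P hPS hP1 hP2 using fun w : W => hS.exists_between w (hWne w w.2)
  have := hWc.to_subtype
  refine ⟨Set.range P ∪ Set.range (fun w => ((P w).2, z)) ∪ {(a, z), (b, z)}, ?_, ?_, ?_⟩
  · exact ((Set.countable_range _).union (Set.countable_range _)).union
      (Set.toFinite {(a, z), (b, z)}).countable
  · rintro _ ((⟨w, rfl⟩ | ⟨w, rfl⟩) | (rfl | rfl))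
    · exact (hP2 w).ne_left
    · exact (hP2 w).ne_right
    · exact ha.ne
    · exact hb.ne'
  · intro r' hr'
    refine ⟨fun w hw => ?_, ⟨a, ha, hr' (a, z) (by simp)⟩, ⟨b, hb, hr' (b, z) (by simp)⟩⟩
    obtain ⟨w', hw', hww'⟩ := hW w hw
    exact ⟨P ⟨w', hw'⟩, hPS _, (hP1 ⟨w', hw'⟩).of_approach hww', hP2 _,
      hr' _ (Or.inl (Or.inl ⟨_, rfl⟩)), hr' _ (Or.inl (Or.inr ⟨⟨w', hw'⟩, rfl⟩))⟩

/-- Countably many visible points each require countably many separations, which one convex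
metrizable refinement can provide. -/
theorem MetrizableQuotient.exists_resolving_refinement (hRc : R.Countable)
    (hR : ∀ c ∈ R, c.2 ∈ level K c.1)
    (hS : ∀ k, ∀ z ∈ level K (k + 1), IsWitnessFamily (level K k) z (S k z))
    (q : MetrizableQuotient K) :
    ∃ q' : MetrizableQuotient K, q ≤ q' ∧ q'.IsConvex ∧
      ∀ d k z, (k + 1, z) ∈ visible S R q.1 d → Resolves S q.1 q'.1 k z := by
  let V : Set (ℕ × K) := {c | ∃ d, (c.1 + 1, c.2) ∈ visible S R q.1 d}
  have hV : V.Countable := by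
    have : V = ⋃ d, (fun c : ℕ × K => (c.1 + 1, c.2)) ⁻¹' visible S R q.1 d := by
      ext c
      simp [V]
    rw [this]
    refine Set.countable_iUnion fun d => (countable_visible hRc hR hS q d).preimage ?_
    rintro ⟨k, z⟩ ⟨k', z'⟩ h
    simpa using h
  have hlev : ∀ c : V, c.1.2 ∈ level K (c.1.1 + 1) := by
    rintro ⟨c, d, hd⟩
    exact visible_subset_level hR hS q.1 hd
  choose T hTc hTne hT using fun c : V =>
    q.exists_countable_resolving (hlev c) (hS c.1.1 c.1.2 (hlev c))
  have := hV.to_subtype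
  obtain ⟨q', hle, hconv, hsep⟩ := q.exists_convex_refinement (Set.countable_iUnion hTc)
    (fun P hP => by
      obtain ⟨c, hc⟩ := Set.mem_iUnion.1 hP
      exact hTne c P hc)
  exact ⟨q', hle, hconv, fun d k z hz =>
    hT ⟨(k, z), d, hz⟩ q'.1 fun P hP => hsep P (Set.mem_iUnion.2 ⟨_, hP⟩)⟩

/-- The convex quotients which resolve all their visible points form a closed cofinal set. -/
theorem isClosedCofinal_resolving (hRc : R.Countable) (hR : ∀ c ∈ R, c.2 ∈ level K c.1)
    (hS : ∀ k, ∀ z ∈ level K (k + 1), IsWitnessFamily (level K k) z (S k z)) :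
    IsClosedCofinal {q : MetrizableQuotient K | q.IsConvex ∧
      ∀ d k z, (k + 1, z) ∈ visible S R q.1 d → Resolves S q.1 q.1 k z} := by
  have hconv : ∀ s : ℕ → MetrizableQuotient K, (∀ n, (s n).IsConvex) →
      (MetrizableQuotient.iSup s).IsConvex := fun s hs x y z hxy hyz h =>
    (MetrizableQuotient.iSup_rel s).2 fun n =>
      hs n hxy hyz ((MetrizableQuotient.iSup_rel s).1 h n)
  constructor
  · intro p
    obtain ⟨p', hpp', hp'⟩ := p.exists_convex_refinement Set.countable_empty (by simp)
    choose next hle hcon hnext using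
      MetrizableQuotient.exists_resolving_refinement (K := K) hRc hR hS
    let s : ℕ → MetrizableQuotient K := fun n => next^[n] p'
    have hsucc : ∀ n, s (n + 1) = next (s n) := fun n => Function.iterate_succ_apply' next n p'
    have hmono : Monotone s := monotone_nat_of_le_succ fun n => (hsucc n).symm ▸ hle (s n)
    refine ⟨MetrizableQuotient.iSup s, ⟨hconv s fun n => ?_, fun d k z hz =>
      resolves_iSup hmono (fun n d k z hz => ?_) hz⟩, ?_⟩
    · cases n with
      | zero => exact hp'.1
      | succ n => exact (hsucc n).symm ▸ hcon (s n)
    · rw [hsucc]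
      exact hnext (s n) d k z hz
    · exact hpp'.trans ((MetrizableQuotient.isLUB_iSup s).1 ⟨0, rfl⟩)
  · intro s hs hF
    refine ⟨MetrizableQuotient.iSup s, ⟨hconv s fun n => (hF n).1, fun d k z hz =>
      resolves_iSup hs (fun n d k z hz => ?_) hz⟩, MetrizableQuotient.isLUB_iSup s⟩
    exact ((hF n).2 d k z hz).mono (hs (Nat.le_succ n))

end Visible

/-! ### Internal order in the quotient line -/

section Represented

variable {K L : Type u} [LinearOrder K] [TopologicalSpace K] [LinearOrder L] [TopologicalSpace L]
  {q : MetrizableQuotient K} {f : K → L} {S : ℕ → K → Set (K × K)} {R : Set (ℕ × K)}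

theorem MetrizableQuotient.IsRepresentedBy.apply_eq_iff (hf : q.IsRepresentedBy f) {x y : K} :
    f x = f y ↔ q.1 x y := by
  rw [← hf.ker_eq, Setoid.ker_def]

theorem MetrizableQuotient.IsRepresentedBy.apply_lt (hf : q.IsRepresentedBy f) {x y : K}
    (hxy : x < y) (h : ¬ q.1 x y) : f x < f y :=
  lt_of_le_of_ne (hf.monotone hxy.le) fun he => h (hf.apply_eq_iff.1 he)

/-- The image of a resolved point is approached from the left by the images of the separated pairs
of its family. -/
theorem Resolves.nonempty_and_isLUB (hf : q.IsRepresentedBy f) {k : ℕ} {z : K}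
    (h : Resolves S q.1 q.1 k z) {B : Set L}
    (hB : ∀ P ∈ S k z, ¬ q.1 P.1 P.2 → ¬ q.1 P.2 z → f P.2 ∈ B) :
    {y | y ∈ B ∧ y < f z}.Nonempty ∧ IsLUB {y | y ∈ B ∧ y < f z} (f z) := by
  have key : ∀ w < z, ¬ q.1 w z → ∃ y ∈ B, f w < y ∧ y < f z := by
    intro w hwz hw
    obtain ⟨P, hP, h1, h2, h3, h4⟩ := h.1 w hw
    have hP1 : w < P.1 ∧ P.1 < z := h1.resolve_right fun h' => (h'.1.trans h'.2).asymm hwz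
    have hP2 : P.1 < P.2 ∧ P.2 < z := h2.resolve_right fun h' => (h'.1.trans h'.2).asymm hP1.2
    exact ⟨f P.2, hB P hP h3 h4, (hf.monotone hP1.1.le).trans_lt (hf.apply_lt hP2.1 h3),
      hf.apply_lt hP2.2 h4⟩
  obtain ⟨w, hwz, hw⟩ := h.2.1
  obtain ⟨y, hy, -, hyz⟩ := key w hwz hw
  refine ⟨⟨y, hy, hyz⟩, fun y hy => hy.2.le, fun b hb => ?_⟩
  by_contra! hlt
  obtain ⟨w, rfl⟩ := hf.surjective b
  obtain ⟨y, hy, hwy, hyz⟩ := key w (hf.monotone.reflect_lt hlt)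
    fun h => hlt.ne (hf.apply_eq_iff.2 h)
  exact (hb ⟨hy, hyz⟩).not_gt hwy

/-- The image of a resolved point is approached from the right by the images of the separated
pairs of its family. -/
theorem Resolves.nonempty_and_isGLB (hf : q.IsRepresentedBy f) {k : ℕ} {z : K}
    (h : Resolves S q.1 q.1 k z) {B : Set L}
    (hB : ∀ P ∈ S k z, ¬ q.1 P.1 P.2 → ¬ q.1 P.2 z → f P.2 ∈ B) :
    {y | y ∈ B ∧ f z < y}.Nonempty ∧ IsGLB {y | y ∈ B ∧ f z < y} (f z) := by
  have key : ∀ w, z < w → ¬ q.1 w z → ∃ y ∈ B, y < f w ∧ f z < y := by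
    intro w hwz hw
    obtain ⟨P, hP, h1, h2, h3, h4⟩ := h.1 w hw
    have hP1 : z < P.1 ∧ P.1 < w := h1.resolve_left fun h' => (h'.1.trans h'.2).asymm hwz
    have hP2 : z < P.2 ∧ P.2 < P.1 := h2.resolve_left fun h' => (h'.1.trans h'.2).asymm hP1.1
    exact ⟨f P.2, hB P hP h3 h4,
      (hf.apply_lt hP2.2 fun h => h3 (q.1.symm' h)).trans_le (hf.monotone hP1.2.le),
      hf.apply_lt hP2.1 fun h => h4 (q.1.symm' h)⟩
  obtain ⟨w, hwz, hw⟩ := h.2.2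
  obtain ⟨y, hy, -, hyz⟩ := key w hwz hw
  refine ⟨⟨y, hy, hyz⟩, fun y hy => hy.2.le, fun b hb => ?_⟩
  by_contra! hlt
  obtain ⟨w, rfl⟩ := hf.surjective b
  obtain ⟨y, hy, hwy, hyz⟩ := key w (hf.monotone.reflect_lt hlt)
    fun h => hlt.ne' (hf.apply_eq_iff.2 h)
  exact (hb ⟨hy, hyz⟩).not_gt hwy

theorem Resolves.isInternal [OrderTopology L] (hf : q.IsRepresentedBy f) {k : ℕ} {z : K}
    (h : Resolves S q.1 q.1 k z) : IsInternal (f z) := by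
  have hl := h.nonempty_and_isLUB hf (B := Set.univ) fun _ _ _ _ => trivial
  have hr := h.nonempty_and_isGLB hf (B := Set.univ) fun _ _ _ _ => trivial
  refine not_or.2 ⟨?_, ?_⟩
  · exact ((hr.2.nhdsWithin_neBot hr.1).mono (nhdsWithin_mono _ fun y hy => hy.2)).ne
  · exact ((hl.2.nhdsWithin_neBot hl.1).mono (nhdsWithin_mono _ fun y hy => hy.2)).ne

variable [CompactSpace K] [OrderTopology L]

/-- In a quotient that resolves its visible points, a visible point of level `k + 1` has image of
internal order at least `k`. -/
theorem orderGE_of_mem_visible (hf : q.IsRepresentedBy f)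
    (hR : ∀ c ∈ R, c.2 ∈ level K c.1)
    (hS : ∀ k, ∀ z ∈ level K (k + 1), IsWitnessFamily (level K k) z (S k z))
    (hq : ∀ d k z, (k + 1, z) ∈ visible S R q.1 d → Resolves S q.1 q.1 k z)
    {d k : ℕ} {z : K} (hz : (k + 1, z) ∈ visible S R q.1 d) :
    OrderGE (internalNontrivial f) k (f z) := by
  induction k generalizing d z with
  | zero => ?_
  | succ k ih => ?_
  all_goals
    have hres := hq _ _ _ hz
    have hlev : z ∈ level K _ := visible_subset_level hR hS q.1 hz
    have hmem : f z ∈ internalNontrivial f := by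
      refine ⟨hres.isInternal hf, ?_⟩
      by_contra hcon
      -- A trivial fiber would give z a countable neighbourhood base, but z lies in M(K).
      refine hlev.1.2 (q.isCountablyGenerated_nhds fun w hw => ?_)
      exact Set.not_nontrivial_iff.1 hcon (hf.apply_eq_iff.2 hw) rfl
  · exact hmem
  · let B : Set L := {y | y ∈ internalNontrivial f ∧ OrderGE (internalNontrivial f) k y}
    have hB : ∀ P ∈ S (k + 1) z, ¬ q.1 P.1 P.2 → ¬ q.1 P.2 z → f P.2 ∈ B := by
      intro P hP h1 h2
      have hP' : OrderGE (internalNontrivial f) k (f P.2) :=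
        ih (d := d + 1) ⟨z, hz, P, hP, rfl, h1, h2⟩
      exact ⟨hP'.mem, hP'⟩
    have hl := hres.nonempty_and_isLUB hf hB
    have hr := hres.nonempty_and_isGLB hf hB
    have el : {y | y ∈ B ∧ y < f z} =
        {y | y ∈ internalNontrivial f ∧ y < f z ∧ OrderGE (internalNontrivial f) k y} := by
      ext y
      exact ⟨fun h => ⟨h.1.1, h.2, h.1.2⟩, fun h => ⟨⟨h.1, h.2.2⟩, h.2.1⟩⟩
    have er : {y | y ∈ B ∧ f z < y} =
        {y | y ∈ internalNontrivial f ∧ f z < y ∧ OrderGE (internalNontrivial f) k y} := by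
      ext y
      exact ⟨fun h => ⟨h.1.1, h.2, h.1.2⟩, fun h => ⟨⟨h.1, h.2.2⟩, h.2.1⟩⟩
    rw [el] at hl
    rw [er] at hr
    exact ⟨hmem, hl.1, hr.1, hl.2, hr.2⟩

end Represented

/-! ### Comparison of internal orders and conclusion -/

theorem internalOrder_le_internalOrder {X Y : Type u} [LinearOrder X] [LinearOrder Y]
    {A : Set X} {B : Set Y} (h : ∀ n x, OrderGE A n x → ∃ y, OrderGE B n y) :
    internalOrder A ≤ internalOrder B := by
  have key : ∀ n y, OrderGE B n y → ((n : ℕ∞) : WithBot ℕ∞) ≤ internalOrder B := fun n y hy =>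
    (WithBot.coe_le_coe.2 (le_iSup₂ (f := fun (n : ℕ) (_ : OrderGE B n y) => (n : ℕ∞)) n hy)).trans
      (le_iSup₂ (f := fun (y : Y) (_ : y ∈ B) => (pointOrder B y : WithBot ℕ∞)) y hy.mem)
  refine iSup₂_le fun x hx => ?_
  -- The case n = 0 makes B nonempty, so its order is not `⊥` and the comparison can be made in
  -- `ℕ∞`.
  obtain ⟨y, hy⟩ := h 0 x hx
  obtain ⟨b, hb, -⟩ := WithBot.coe_le_iff.1 (key 0 y hy)
  rw [hb, WithBot.coe_le_coe]
  refine iSup₂_le fun n hn => ?_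
  obtain ⟨y, hy⟩ := h n x hn
  have := key n y hy
  rwa [hb, WithBot.coe_le_coe] at this

end CompactLine

theorem mainTheorem8 (K : Type u) [LinearOrder K] [TopologicalSpace K] [OrderTopology K]
    [CompactSpace K] :
    CompactLine.TypicalQuotient K fun q =>
      q.IsOrderPreserving ∧
        ∀ (L : Type u) [LinearOrder L] [TopologicalSpace L] [OrderTopology L] (f : K → L),
          q.IsRepresentedBy f →
            CompactLine.internalOrder (CompactLine.internalUncountable K) ≤
              CompactLine.internalOrder (CompactLine.internalNontrivial f) := by
  open CompactLine in
  have hfam : ∀ k, ∀ z : K, ∃ S : Set (K × K),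
      z ∈ level K (k + 1) → IsWitnessFamily (level K k) z S := by
    intro k z
    by_cases hz : z ∈ level K (k + 1)
    · obtain ⟨S, hS⟩ := exists_isWitnessFamily hz.2.1 hz.2.2
      exact ⟨S, fun _ => hS⟩
    · exact ⟨∅, fun h => absurd h hz⟩
  choose S hS using hfam
  -- One root in every nonempty level: the roots are fixed before n, and io(M(K)) may be infinite
  -- without any single point attaining it.
  let R : Set (ℕ × K) := ⋃ k, {c | ∃ h : (level K k).Nonempty, c = (k, h.some)}
  have hRc : R.Countable := by
    refine Set.countable_iUnion fun k => Set.Subsingleton.countable ?_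
    rintro _ ⟨_, rfl⟩ _ ⟨_, rfl⟩
    rfl
  have hR : ∀ c ∈ R, c.2 ∈ level K c.1 := by
    intro c hc
    obtain ⟨k, h, rfl⟩ := Set.mem_iUnion.1 hc
    exact h.some_mem
  refine ⟨_, isClosedCofinal_resolving hRc hR hS, fun q hq => ⟨hq.1.isOrderPreserving, ?_⟩⟩
  intro L _ _ _ f hf
  refine internalOrder_le_internalOrder fun n x hx => ?_
  have hne : (level K (n + 1)).Nonempty := ⟨x, mem_level_of_orderGE hx⟩
  exact ⟨f hne.some, orderGE_of_mem_visible (d := 0) hf hR hS hq.2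
    (Set.mem_iUnion.2 ⟨n + 1, hne, rfl⟩)⟩
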